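/- **Joint Lower Bound.** Fix $K$ arms $a_1,\dots,a_K$ with known costs $c_1\le\dots\le c_K$ and a subsidy factor $\alpha\in[0,1)$. An instance is a mean vector $\mu\in\mathbb R^K$: pulling $a_k$ yields an independent reward with law $\mathcal N(\mu_k,1)$. Let $\mu^*=\max_k\mu_k$. Arm $a_k$ is feasible if $\mu_k\ge(1-\alpha)\mu^*$, and the optimal arm $a^*$ is the cheapest feasible arm (ties in cost are broken by the smaller index); it exists if and only if some arm is feasible. A (possibly randomized) policy maps, in each round, the history of pulled arms and observed rewards to a distribution over the arms; it may depend on $c$, $\alpha$ and the horizon $T$. Let $n_i(T)$ be the number of pulls of $a_i$ in the first $T$ rounds. The policy is consistent if on every instance that has an optimal arm, for every arm $a_i\ne a^*$ and every $0<\gamma\le1$, $\mathbb E[n_i(T)]=o(T^\gamma)$ as $T\to\infty$. Consider a consistent policy on an instance $\mu$ that has an optimal arm $a^*$ and at least one cheap arm, i.e. an arm whose index is smaller than that of $a^*$. Let $a_\dagger$ be a cheap arm with the highest mean $\mu_\dagger$ among the cheap arms, let $\Delta_{k,\dagger}=(1-\alpha)\mu_k-\mu_\dagger$, and let $\mathcal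 A^\dagger=\{a_k : \Delta_{k,\dagger}>0\}$, where $a_k$ ranges over all arms. Then $$\liminf_{T\to\infty}\frac{\sum_{a_i\in\mathcal A^\dagger}\Delta_{i,\dagger}^2\,\mathbb E[n_i(T)]}{\log T}\ \ge\ 2(1-\alpha)^2,$$ where the $\liminf$ is taken in $[-\infty,\infty]$. -/

import Mathlib

open MeasureTheory ProbabilityTheory Filter Topology Asymptotics

/-- The observation history after `t` rounds of a `K`-armed bandit: for every past round, the arm
that was pulled and the reward that was observed. -/
abbrev BanditHistory (K t : ℕ) : Type := Fin t → Fin K × ℝ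

/-- A (possibly randomized) policy: in every round it maps the observation history, measurably, to
a probability distribution over the `K` arms. Deterministic policies are the special case of
Dirac distributions. -/
structure BanditPolicy (K : ℕ) where
  /-- The distribution of the next arm given the first `t` rounds. -/
  decide : (t : ℕ) → Kernel (BanditHistory K t) (Fin K)
  isMarkov : ∀ t, IsMarkovKernel (decide t)

namespace CostSubsidy

noncomputable section

variable {K : ℕ}

/-! ### The interaction of a policy with a unit-variance Gaussian bandit -/

/-- Pulling arm `k` produces a Gaussian reward with mean `μ k` and variance `1`. -/
def rewardKernel (μ : Fin K → ℝ) : Kernel (Fin K) ℝ :=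
  Kernel.ofFunOfCountable fun k => gaussianReal (μ k) 1

/-- One round: given the history, the policy draws an arm, and then the reward is drawn from the
distribution of that arm, independently of the history. -/
def roundKernel (π : BanditPolicy K) (μ : Fin K → ℝ) (t : ℕ) :
    Kernel (BanditHistory K t) (Fin K × ℝ) :=
  π.decide t ⊗ₖ Kernel.prodMkLeft (BanditHistory K t) (rewardKernel μ)

/-- The law of the history of the first `t` rounds when `π` interacts with the instance `μ`. -/
def historyLaw (π : BanditPolicy K) (μ : Fin K → ℝ) : (t : ℕ) → Measure (BanditHistory K t)
  | 0 => Measure.dirac Fin.elim0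
  | t + 1 => (historyLaw π μ t ⊗ₘ roundKernel π μ t).map
      fun p => (Fin.snoc p.1 p.2 : BanditHistory K (t + 1))

/-- The number of pulls of arm `i` in a history. -/
def pulls {t : ℕ} (h : BanditHistory K t) (i : Fin K) : ℕ :=
  (Finset.univ.filter fun s : Fin t => (h s).1 = i).card

/-- The expected number of pulls of arm `i` in the first `T` rounds. -/
def expectedPulls (π : BanditPolicy K) (μ : Fin K → ℝ) (T : ℕ) (i : Fin K) : ℝ :=
  ∫ h, (pulls h i : ℝ) ∂(historyLaw π μ T)

/-! ### The cost-subsidy objective -/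

/-- The best expected reward `max_k μ k`. -/
def bestReward (μ : Fin K → ℝ) : ℝ := ⨆ k, μ k

/-- Arm `k` is feasible: its expected reward is at least `(1 - α)` times the best one. -/
def IsFeasible (α : ℝ) (μ : Fin K → ℝ) (k : Fin K) : Prop :=
  (1 - α) * bestReward μ ≤ μ k

/-- Arm `a` is the optimal arm: the cheapest feasible arm, where ties between equal costs are
broken by the index. -/
def IsOptimalArm (c : Fin K → ℝ) (α : ℝ) (μ : Fin K → ℝ) (a : Fin K) : Prop :=
  IsFeasible α μ a ∧ ∀ k, IsFeasible α μ k → c a < c k ∨ (c a = c k ∧ a ≤ k)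

/-- Arm `d` is a best reward cheap arm: it bears the highest expected reward among the cheap arms,
the arms that precede the optimal arm `a` in the cost order. -/
def IsBestCheapArm (μ : Fin K → ℝ) (a d : Fin K) : Prop :=
  d < a ∧ ∀ k, k < a → μ k ≤ μ d

/-- Consistency, for known costs `c` and subsidy factor `α`, of a policy that may be tuned to the
horizon (`π T` is the policy used for horizon `T`; it is constant in `T` for a policy that does not
know the horizon): on every instance that has an optimal arm, every other arm is pulled `o(T ^ γ)`
times in expectation, for all `0 < γ ≤ 1`. -/
def IsConsistent (c : Fin K → ℝ) (α : ℝ) (π : ℕ → BanditPolicy K) : Prop :=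
  ∀ (μ : Fin K → ℝ) (a : Fin K), IsOptimalArm c α μ a → ∀ i, i ≠ a →
    ∀ γ : ℝ, 0 < γ → γ ≤ 1 →
      (fun T : ℕ => expectedPulls (π T) μ T i) =o[atTop] fun T : ℕ => (T : ℝ) ^ γ

/-- The gap `Δ_{k,d} = (1 - α) μ_k - μ_d`. -/
def gap (α : ℝ) (μ : Fin K → ℝ) (d k : Fin K) : ℝ := (1 - α) * μ k - μ d

/-- The arms with reward sufficient to eliminate the arm `d`. -/
def eliminators (α : ℝ) (μ : Fin K → ℝ) (d : Fin K) : Finset (Fin K) :=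
  open Classical in Finset.univ.filter fun k => 0 < gap α μ d k

end

end CostSubsidy

namespace CostSubsidy

noncomputable section

variable {K : ℕ}

/-! If the optimal arm `a` is itself an eliminator of `d`, consistency makes its pull count grow
like `T`, and the quotient diverges. Otherwise lower every eliminator to `μ d / (1 - α)`. On the new
instance `d` is feasible, so the optimal arm there has index at most `d`, hence differs from `a`. A
consistent policy must pull `a` almost always on `μ` but only `o(T ^ γ)` times on the new instance,
so the two history laws have divergence at least about `(1 - γ) log T`
(`exists_tendsto_le_divergence`). By the divergence decomposition (`integral_historyLLR`) this
divergence is a sum over the lowered arms, each contributing its expected pull count times `gap ^ 2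
/ (2 (1 - α) ^ 2)`. Letting `γ → 0` gives the constant. -/

instance isMarkovKernel_decide (π : BanditPolicy K) (t : ℕ) : IsMarkovKernel (π.decide t) :=
  π.isMarkov t

instance isMarkovKernel_rewardKernel (μ : Fin K → ℝ) : IsMarkovKernel (rewardKernel μ) :=
  ⟨fun k => by
    change IsProbabilityMeasure (gaussianReal (μ k) 1)
    infer_instance⟩

instance isMarkovKernel_roundKernel (π : BanditPolicy K) (μ : Fin K → ℝ) (t : ℕ) :
    IsMarkovKernel (roundKernel π μ t) := by
  unfold roundKernel
  infer_instance

theorem measurable_snoc (t : ℕ) :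
    Measurable fun p : BanditHistory K t × (Fin K × ℝ) =>
      (Fin.snoc p.1 p.2 : BanditHistory K (t + 1)) := by
  refine measurable_pi_lambda _ fun i => ?_
  induction i using Fin.lastCases with
  | last => simpa using measurable_snd
  | cast i =>
    simp only [Fin.snoc_castSucc]
    exact (measurable_pi_apply i).comp measurable_fst

instance isProbabilityMeasure_historyLaw (π : BanditPolicy K) (μ : Fin K → ℝ) :
    ∀ t, IsProbabilityMeasure (historyLaw π μ t)
  | 0 => by unfold historyLaw; infer_instance
  | t + 1 => by
    have := isProbabilityMeasure_historyLaw π μ t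
    unfold historyLaw
    exact Measure.isProbabilityMeasure_map (measurable_snoc t).aemeasurable

/-! ### Likelihood ratios and change of measure. -/

/-- The centred part of the log-likelihood ratio of one observation, `μ` against `ν`. -/
def noise (μ ν : Fin K → ℝ) (p : Fin K × ℝ) : ℝ := (μ p.1 - ν p.1) * (p.2 - μ p.1)

/-- The log-likelihood ratio of one observation, `μ` against `ν`. -/
def obsLLR (μ ν : Fin K → ℝ) (p : Fin K × ℝ) : ℝ := noise μ ν p + (μ p.1 - ν p.1) ^ 2 / 2

/-- The log-likelihood ratio of a history, `μ` against `ν`. -/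
def historyLLR (μ ν : Fin K → ℝ) {t : ℕ} (h : BanditHistory K t) : ℝ := ∑ s, obsLLR μ ν (h s)

theorem measurable_noise (μ ν : Fin K → ℝ) : Measurable (noise μ ν) := by
  have h (f : Fin K → ℝ) : Measurable fun p : Fin K × ℝ => f p.1 :=
    (measurable_of_countable f).comp measurable_fst
  exact ((h μ).sub (h ν)).mul (measurable_snd.sub (h μ))

theorem measurable_obsLLR (μ ν : Fin K → ℝ) : Measurable (obsLLR μ ν) := by
  have h (f : Fin K → ℝ) : Measurable fun p : Fin K × ℝ => f p.1 :=
    (measurable_of_countable f).comp measurable_fst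
  exact (measurable_noise μ ν).add ((((h μ).sub (h ν)).pow_const 2).div_const 2)

theorem measurable_historyLLR (μ ν : Fin K → ℝ) (t : ℕ) :
    Measurable (historyLLR μ ν : BanditHistory K t → ℝ) :=
  Finset.measurable_sum _ fun s _ => (measurable_obsLLR μ ν).comp (measurable_pi_apply s)

theorem gaussianPDF_change_mean (m n x : ℝ) :
    gaussianPDF n 1 x =
      gaussianPDF m 1 x * ENNReal.ofReal (Real.exp (-((m - n) * (x - m) + (m - n) ^ 2 / 2))) := by
  rw [gaussianPDF, gaussianPDF, ← ENNReal.ofReal_mul (gaussianPDFReal_nonneg _ _ _)]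
  congr 1
  simp only [gaussianPDFReal, mul_assoc, ← Real.exp_add]
  congr 3
  simp
  ring

theorem lintegral_gaussianReal_change_mean (m n : ℝ) {f : ℝ → ENNReal} (hf : Measurable f) :
    ∫⁻ x, f x ∂gaussianReal n 1 =
      ∫⁻ x, f x * ENNReal.ofReal (Real.exp (-((m - n) * (x - m) + (m - n) ^ 2 / 2)))
        ∂gaussianReal m 1 := by
  rw [gaussianReal_of_var_ne_zero _ one_ne_zero, gaussianReal_of_var_ne_zero _ one_ne_zero,
    lintegral_withDensity_eq_lintegral_mul _ (measurable_gaussianPDF _ _) hf,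
    lintegral_withDensity_eq_lintegral_mul _ (measurable_gaussianPDF _ _) (by fun_prop)]
  refine lintegral_congr fun x => ?_
  simp only [Pi.mul_apply]
  rw [gaussianPDF_change_mean m n x]
  ring

/-- The policy draws the arm from the same law under both instances, so only the Gaussian reward
density contributes to the ratio. -/
theorem lintegral_roundKernel_change_mean (π : BanditPolicy K) (μ ν : Fin K → ℝ) (t : ℕ)
    (h : BanditHistory K t) {f : Fin K × ℝ → ENNReal} (hf : Measurable f) :
    ∫⁻ p, f p ∂roundKernel π ν t h =
      ∫⁻ p, f p * ENNReal.ofReal (Real.exp (-obsLLR μ ν p)) ∂roundKernel π μ t h := by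
  have hw : Measurable fun p => f p * ENNReal.ofReal (Real.exp (-obsLLR μ ν p)) :=
    hf.mul (measurable_obsLLR μ ν).neg.exp.ennreal_ofReal
  rw [roundKernel, roundKernel, Kernel.lintegral_compProd _ _ _ hf,
    Kernel.lintegral_compProd _ _ _ hw]
  refine lintegral_congr fun k => ?_
  exact lintegral_gaussianReal_change_mean (μ k) (ν k) (hf.comp measurable_prodMk_left)

theorem historyLLR_snoc (μ ν : Fin K → ℝ) {t : ℕ} (h : BanditHistory K t) (p : Fin K × ℝ) :
    historyLLR μ ν (Fin.snoc h p : BanditHistory K (t + 1)) =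
      historyLLR μ ν h + obsLLR μ ν p := by
  simp [historyLLR, Fin.sum_univ_castSucc]

/-- Change of measure between two instances. -/
theorem lintegral_historyLaw_change_mean (π : BanditPolicy K) (μ ν : Fin K → ℝ) :
    ∀ (t : ℕ) {f : BanditHistory K t → ENNReal}, Measurable f →
      ∫⁻ h, f h ∂historyLaw π ν t =
        ∫⁻ h, f h * ENNReal.ofReal (Real.exp (-historyLLR μ ν h)) ∂historyLaw π μ t
  | 0, f, hf => by simp [historyLaw, historyLLR]
  | t + 1, f, hf => by
    have hw : Measurable fun h : BanditHistory K (t + 1) =>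
        f h * ENNReal.ofReal (Real.exp (-historyLLR μ ν h)) :=
      hf.mul (measurable_historyLLR μ ν _).neg.exp.ennreal_ofReal
    have hs : Measurable fun p : BanditHistory K t × (Fin K × ℝ) =>
        f (Fin.snoc p.1 p.2 : BanditHistory K (t + 1)) := hf.comp (measurable_snoc t)
    have hws : Measurable fun p : BanditHistory K t × (Fin K × ℝ) =>
        f (Fin.snoc p.1 p.2 : BanditHistory K (t + 1)) *
          ENNReal.ofReal (Real.exp (-historyLLR μ ν
            (Fin.snoc p.1 p.2 : BanditHistory K (t + 1)))) := hw.comp (measurable_snoc t)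
    rw [historyLaw, historyLaw, lintegral_map hf (measurable_snoc t),
      lintegral_map hw (measurable_snoc t), Measure.lintegral_compProd hs,
      Measure.lintegral_compProd hws,
      lintegral_historyLaw_change_mean π μ ν t hs.lintegral_kernel_prod_right']
    refine lintegral_congr fun h => ?_
    have hsh : Measurable fun p : Fin K × ℝ => f (Fin.snoc h p : BanditHistory K (t + 1)) :=
      hs.comp measurable_prodMk_left
    rw [lintegral_roundKernel_change_mean π μ ν t h hsh, ← lintegral_mul_const]
    · refine lintegral_congr fun p => ?_
      rw [historyLLR_snoc, neg_add, Real.exp_add, ENNReal.ofReal_mul (Real.exp_nonneg _)]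
      ring
    · exact hsh.mul (measurable_obsLLR μ ν).neg.exp.ennreal_ofReal

/-! ### The noise part of the log-likelihood ratio has mean zero. -/

theorem integrable_noise_gaussianReal (μ ν : Fin K → ℝ) (k : Fin K) :
    Integrable (fun x => noise μ ν (k, x)) (gaussianReal (μ k) 1) := by
  have h : Integrable (fun x : ℝ => x) (gaussianReal (μ k) 1) :=
    (memLp_id_gaussianReal (μ := μ k) (v := 1) 1).integrable (by simp)
  simp only [noise]
  exact (h.sub (integrable_const (μ k))).const_mul _

theorem integral_noise_gaussianReal (μ ν : Fin K → ℝ) (k : Fin K) :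
    ∫ x, noise μ ν (k, x) ∂gaussianReal (μ k) 1 = 0 := by
  have h : Integrable (fun x : ℝ => x) (gaussianReal (μ k) 1) :=
    (memLp_id_gaussianReal (μ := μ k) (v := 1) 1).integrable (by simp)
  simp only [noise]
  rw [integral_const_mul, integral_sub h (integrable_const _), integral_id_gaussianReal]
  simp

theorem integrable_noise_roundKernel (π : BanditPolicy K) (μ ν : Fin K → ℝ) (t : ℕ)
    (h : BanditHistory K t) : Integrable (noise μ ν) (roundKernel π μ t h) := by
  rw [roundKernel, integrable_compProd_iff (measurable_noise μ ν).aestronglyMeasurable]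
  exact ⟨ae_of_all _ fun k => integrable_noise_gaussianReal μ ν k, Integrable.of_finite⟩

theorem integral_noise_roundKernel (π : BanditPolicy K) (μ ν : Fin K → ℝ) (t : ℕ)
    (h : BanditHistory K t) : ∫ p, noise μ ν p ∂roundKernel π μ t h = 0 := by
  have hi := integrable_noise_roundKernel π μ ν t h
  rw [roundKernel] at hi ⊢
  rw [integral_compProd hi]
  exact integral_eq_zero_of_ae (ae_of_all _ fun k => integral_noise_gaussianReal μ ν k)

/-- Summing over the finitely many arms makes the bound independent of the history, which yields
integrability under the joint law. -/
theorem integral_norm_noise_roundKernel_le (π : BanditPolicy K) (μ ν : Fin K → ℝ) (t : ℕ)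
    (h : BanditHistory K t) :
    ∫ p, ‖noise μ ν p‖ ∂roundKernel π μ t h ≤
      ∑ k, ∫ x, ‖noise μ ν (k, x)‖ ∂gaussianReal (μ k) 1 := by
  have hi := (integrable_noise_roundKernel π μ ν t h).norm
  rw [roundKernel] at hi ⊢
  rw [integral_compProd hi]
  calc _ ≤ ∫ _, ∑ k, ∫ x, ‖noise μ ν (k, x)‖ ∂gaussianReal (μ k) 1 ∂π.decide t h := by
        refine integral_mono Integrable.of_finite (integrable_const _) fun k => ?_
        exact Finset.single_le_sum (f := fun k => ∫ x, ‖noise μ ν (k, x)‖ ∂gaussianReal (μ k) 1)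
          (fun _ _ => integral_nonneg fun _ => norm_nonneg _) (Finset.mem_univ k)
    _ = _ := by simp

theorem integrable_noise_compProd (π : BanditPolicy K) (μ ν : Fin K → ℝ) (t : ℕ) :
    Integrable (fun p => noise μ ν p.2) (historyLaw π μ t ⊗ₘ roundKernel π μ t) := by
  have hm : Measurable fun p : BanditHistory K t × (Fin K × ℝ) => noise μ ν p.2 :=
    (measurable_noise μ ν).comp measurable_snd
  rw [Measure.integrable_compProd_iff hm.aestronglyMeasurable]
  refine ⟨ae_of_all _ fun h => integrable_noise_roundKernel π μ ν t h, ?_⟩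
  refine Integrable.of_bound (C := ∑ k, ∫ x, ‖noise μ ν (k, x)‖ ∂gaussianReal (μ k) 1)
    hm.norm.stronglyMeasurable.integral_kernel_prod_right'.aestronglyMeasurable
    (ae_of_all _ fun h => ?_)
  rw [Real.norm_of_nonneg (integral_nonneg fun _ => norm_nonneg _)]
  exact integral_norm_noise_roundKernel_le π μ ν t h

/-- The centred part of the log-likelihood ratio of a history. -/
def historyNoise (μ ν : Fin K → ℝ) {t : ℕ} (h : BanditHistory K t) : ℝ := ∑ s, noise μ ν (h s)

theorem measurable_historyNoise (μ ν : Fin K → ℝ) (t : ℕ) :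
    Measurable (historyNoise μ ν : BanditHistory K t → ℝ) :=
  Finset.measurable_sum _ fun s _ => (measurable_noise μ ν).comp (measurable_pi_apply s)

theorem historyNoise_snoc (μ ν : Fin K → ℝ) {t : ℕ} (h : BanditHistory K t) (p : Fin K × ℝ) :
    historyNoise μ ν (Fin.snoc h p : BanditHistory K (t + 1)) =
      historyNoise μ ν h + noise μ ν p := by
  simp [historyNoise, Fin.sum_univ_castSucc]

theorem integrable_and_integral_historyNoise (π : BanditPolicy K) (μ ν : Fin K → ℝ) :
    ∀ t : ℕ, Integrable (historyNoise μ ν) (historyLaw π μ t) ∧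
      ∫ h, historyNoise μ ν h ∂historyLaw π μ t = 0
  | 0 => by simp [historyLaw, historyNoise]
  | t + 1 => by
    obtain ⟨hi, h0⟩ := integrable_and_integral_historyNoise π μ ν t
    have hfst : Integrable (fun p : BanditHistory K t × (Fin K × ℝ) => historyNoise μ ν p.1)
        (historyLaw π μ t ⊗ₘ roundKernel π μ t) := by
      have : Integrable (historyNoise μ ν) (historyLaw π μ t ⊗ₘ roundKernel π μ t).fst := by
        rwa [Measure.fst_compProd]
      exact this.comp_measurable measurable_fst
    have hsnd := integrable_noise_compProd π μ ν t
    have hm := (measurable_historyNoise (K := K) μ ν (t + 1)).aestronglyMeasurable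
      (μ := historyLaw π μ (t + 1))
    rw [historyLaw] at hm ⊢
    rw [integrable_map_measure hm (measurable_snoc t).aemeasurable,
      integral_map (measurable_snoc t).aemeasurable hm]
    simp only [Function.comp_def, historyNoise_snoc]
    refine ⟨hfst.add hsnd, ?_⟩
    rw [integral_add hfst hsnd, Measure.integral_compProd hfst, Measure.integral_compProd hsnd]
    simp [integral_noise_roundKernel, h0]

/-! ### Pull counts and the divergence decomposition. -/

theorem sum_arm_eq_sum_pulls {t : ℕ} (h : BanditHistory K t) (f : Fin K → ℝ) :
    ∑ s, f (h s).1 = ∑ k, (pulls h k : ℝ) * f k := by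
  rw [← Finset.sum_fiberwise_of_maps_to (s := Finset.univ) (t := Finset.univ)
    (g := fun s => (h s).1) (fun _ _ => Finset.mem_univ _)]
  refine Finset.sum_congr rfl fun k _ => ?_
  rw [Finset.sum_congr rfl (g := fun _ => f k) fun s hs => by rw [(Finset.mem_filter.1 hs).2]]
  simp [pulls]

theorem measurable_pulls (t : ℕ) (i : Fin K) :
    Measurable fun h : BanditHistory K t => (pulls h i : ℝ) := by
  simp only [pulls, Finset.card_filter, Nat.cast_sum]
  refine Finset.measurable_sum _ fun s _ => ?_
  exact (measurable_of_countable fun k : Fin K => ((if k = i then 1 else 0 : ℕ) : ℝ)).comp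
    (measurable_fst.comp (measurable_pi_apply s))

theorem pulls_le {t : ℕ} (h : BanditHistory K t) (i : Fin K) : pulls h i ≤ t :=
  (Finset.card_le_univ _).trans_eq (Fintype.card_fin t)

theorem integrable_pulls (π : BanditPolicy K) (μ : Fin K → ℝ) (t : ℕ) (i : Fin K) :
    Integrable (fun h : BanditHistory K t => (pulls h i : ℝ)) (historyLaw π μ t) :=
  Integrable.of_bound (C := t) (measurable_pulls t i).aestronglyMeasurable
    (ae_of_all _ fun h => by simpa using pulls_le h i)

theorem expectedPulls_nonneg (π : BanditPolicy K) (μ : Fin K → ℝ) (t : ℕ) (i : Fin K) :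
    0 ≤ expectedPulls π μ t i :=
  integral_nonneg fun _ => Nat.cast_nonneg _

theorem sum_expectedPulls (π : BanditPolicy K) (μ : Fin K → ℝ) (t : ℕ) :
    ∑ i, expectedPulls π μ t i = t := by
  simp only [expectedPulls]
  rw [← integral_finsetSum _ fun i _ => integrable_pulls π μ t i]
  have h1 (h : BanditHistory K t) : ∑ i, (pulls h i : ℝ) = t := by
    simpa using (sum_arm_eq_sum_pulls h fun _ => 1).symm
  simp [h1]

theorem historyLLR_eq (μ ν : Fin K → ℝ) {t : ℕ} (h : BanditHistory K t) :
    historyLLR μ ν h = historyNoise μ ν h + ∑ k, (pulls h k : ℝ) * ((μ k - ν k) ^ 2 / 2) := by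
  rw [← sum_arm_eq_sum_pulls h fun k => (μ k - ν k) ^ 2 / 2]
  simp [historyLLR, historyNoise, obsLLR, Finset.sum_add_distrib]

theorem integrable_historyLLR (π : BanditPolicy K) (μ ν : Fin K → ℝ) (t : ℕ) :
    Integrable (historyLLR μ ν) (historyLaw π μ t) := by
  simp only [funext fun h : BanditHistory K t => historyLLR_eq μ ν h]
  exact (integrable_and_integral_historyNoise π μ ν t).1.add
    (integrable_finsetSum _ fun k _ => (integrable_pulls π μ t k).mul_const _)

/-- The divergence decomposition. -/
theorem integral_historyLLR (π : BanditPolicy K) (μ ν : Fin K → ℝ) (t : ℕ) :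
    ∫ h, historyLLR μ ν h ∂historyLaw π μ t =
      ∑ k, expectedPulls π μ t k * ((μ k - ν k) ^ 2 / 2) := by
  have hp (k : Fin K) := (integrable_pulls π μ t k).mul_const ((μ k - ν k) ^ 2 / 2)
  simp only [historyLLR_eq]
  rw [integral_add (integrable_and_integral_historyNoise π μ ν t).1
    (integrable_finsetSum _ fun k _ => hp k), (integrable_and_integral_historyNoise π μ ν t).2,
    integral_finsetSum _ fun k _ => hp k, zero_add]
  exact Finset.sum_congr rfl fun k _ => integral_mul_const _ _

/-! ### Variational lower bound for the divergence, from Jensen's inequality. -/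

theorem exp_integral_le_integral_exp {Ω : Type*} [MeasurableSpace Ω] (P : Measure Ω)
    [IsProbabilityMeasure P] {f : Ω → ℝ} (hf : Integrable f P)
    (hexp : Integrable (fun ω => Real.exp (f ω)) P) :
    Real.exp (∫ ω, f ω ∂P) ≤ ∫ ω, Real.exp (f ω) ∂P :=
  convexOn_exp.map_integral_le Real.continuous_exp.continuousOn isClosed_univ
    (ae_of_all _ fun _ => Set.mem_univ _) hf hexp

/-- The variational lower bound for the divergence, applied to the test function `f`. -/
theorem exp_integral_sub_le (π : BanditPolicy K) (μ ν : Fin K → ℝ) (t : ℕ)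
    {f : BanditHistory K t → ℝ} (hfm : Measurable f) (hf : Integrable f (historyLaw π μ t))
    (hexp : Integrable (fun h => Real.exp (f h)) (historyLaw π ν t)) :
    Real.exp (∫ h, f h ∂historyLaw π μ t -
        ∑ k, expectedPulls π μ t k * ((μ k - ν k) ^ 2 / 2)) ≤
      ∫ h, Real.exp (f h) ∂historyLaw π ν t := by
  have hL := integrable_historyLLR π μ ν t
  have hm : Measurable fun h => Real.exp (f h - historyLLR μ ν h) :=
    (hfm.sub (measurable_historyLLR μ ν t)).exp
  have key : ∫⁻ h, ENNReal.ofReal (Real.exp (f h)) ∂historyLaw π ν t =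
      ∫⁻ h, ENNReal.ofReal (Real.exp (f h - historyLLR μ ν h)) ∂historyLaw π μ t := by
    rw [lintegral_historyLaw_change_mean π μ ν t hfm.exp.ennreal_ofReal]
    refine lintegral_congr fun h => ?_
    rw [← ENNReal.ofReal_mul (Real.exp_nonneg _), ← Real.exp_add, sub_eq_add_neg]
  -- Integrability under `μ` is inherited from `hexp` through the change of measure.
  have hint : Integrable (fun h => Real.exp (f h - historyLLR μ ν h)) (historyLaw π μ t) := by
    refine ⟨hm.aestronglyMeasurable, ?_⟩
    rw [hasFiniteIntegral_iff_ofReal (ae_of_all _ fun _ => Real.exp_nonneg _), ← key,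
      ← hasFiniteIntegral_iff_ofReal (ae_of_all _ fun _ => Real.exp_nonneg _)]
    exact hexp.2
  have := exp_integral_le_integral_exp _ (hf.sub hL) hint
  simp only [Pi.sub_apply] at this
  rw [integral_sub hf hL, integral_historyLLR] at this
  refine this.trans_eq ?_
  rw [integral_eq_lintegral_of_nonneg_ae (ae_of_all _ fun _ => Real.exp_nonneg _)
      hm.aestronglyMeasurable,
    integral_eq_lintegral_of_nonneg_ae (ae_of_all _ fun _ => Real.exp_nonneg _)
      hfm.exp.aestronglyMeasurable, key]

/-- The expected pull counts of an arm on two instances bound the divergence from below. -/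
theorem mul_expectedPulls_sub_log_le (π : BanditPolicy K) (μ ν : Fin K → ℝ) {T : ℕ} (hT : 0 < T)
    (a : Fin K) (l : ℝ) :
    l * (expectedPulls π μ T a / T) - Real.log (1 + Real.exp l * (expectedPulls π ν T a / T)) ≤
      ∑ k, expectedPulls π μ T k * ((μ k - ν k) ^ 2 / 2) := by
  have hT' : (0 : ℝ) < T := Nat.cast_pos.2 hT
  set f : BanditHistory K T → ℝ := fun h => l * ((pulls h a : ℝ) / T)
  have hfm : Measurable f := ((measurable_pulls T a).div_const _).const_mul _
  have hfint : ∫ h, f h ∂historyLaw π μ T = l * (expectedPulls π μ T a / T) := by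
    simp only [f, expectedPulls]
    rw [integral_const_mul, integral_div]
  have hfi : Integrable f (historyLaw π μ T) := ((integrable_pulls π μ T a).div_const _).const_mul _
  have h01 (h : BanditHistory K T) : (pulls h a : ℝ) / T ≤ 1 :=
    (div_le_one hT').2 (Nat.cast_le.2 (pulls_le h a))
  -- On `[0, 1]` the convex function `exp (l * x)` lies below its chord `1 - x + exp l * x`; this
  -- bounds the exponential moment under `ν` by the expected pull count alone.
  have hchord (h : BanditHistory K T) :
      Real.exp (f h) ≤ 1 + Real.exp l * ((pulls h a : ℝ) / T) := by
    have h0 : (0 : ℝ) ≤ (pulls h a : ℝ) / T := by positivity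
    have := convexOn_exp.2 (Set.mem_univ (0 : ℝ)) (Set.mem_univ l) (sub_nonneg.2 (h01 h)) h0
      (by ring)
    simp only [smul_eq_mul, mul_zero, zero_add, Real.exp_zero, mul_one] at this
    simp only [f]
    rw [mul_comm l]
    linarith
  have hbound : Integrable (fun h => 1 + Real.exp l * ((pulls h a : ℝ) / T)) (historyLaw π ν T) :=
    (integrable_const _).add (((integrable_pulls π ν T a).div_const _).const_mul _)
  have hexp : Integrable (fun h => Real.exp (f h)) (historyLaw π ν T) :=
    hbound.mono' hfm.exp.aestronglyMeasurable
      (ae_of_all _ fun h => by rw [Real.norm_of_nonneg (Real.exp_nonneg _)]; exact hchord h)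
  have h1 := (exp_integral_sub_le π μ ν T hfm hfi hexp).trans
    (integral_mono hexp hbound hchord)
  rw [hfint, integral_add (integrable_const _)
    (((integrable_pulls π ν T a).div_const _).const_mul _), integral_const_mul] at h1
  simp only [integral_const, integral_div, probReal_univ, smul_eq_mul, mul_one] at h1
  have h2 := Real.log_le_log (Real.exp_pos _) h1
  rw [Real.log_exp] at h2
  simp only [expectedPulls] at h2 ⊢
  linarith

/-! ### The alternative instance. -/

theorem exists_isOptimalArm_le {c : Fin K → ℝ} (hc : Monotone c) {α : ℝ} {μ : Fin K → ℝ}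
    {d : Fin K} (hd : IsFeasible α μ d) : ∃ a, IsOptimalArm c α μ a ∧ a ≤ d := by
  obtain ⟨a, ha, hmin⟩ := Set.exists_min_image {k | IsFeasible α μ k} id (Set.toFinite _) ⟨d, hd⟩
  exact ⟨a, ⟨ha, fun k hk => (hc (hmin k hk)).lt_or_eq.imp_right fun h => ⟨h, hmin k hk⟩⟩,
    hmin d hd⟩

/-- The instance in which the eliminators of `d` are lowered until they no longer eliminate
`d`. -/
def loweredInstance (α : ℝ) (μ : Fin K → ℝ) (d k : Fin K) : ℝ :=
  open Classical in if 0 < gap α μ d k then μ d / (1 - α) else μ k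

theorem isFeasible_loweredInstance {α : ℝ} (hα₁ : α < 1) {μ : Fin K → ℝ} {d : Fin K}
    (hd : gap α μ d d ≤ 0) : IsFeasible α (loweredInstance α μ d) d := by
  have hα : 0 < 1 - α := sub_pos.2 hα₁
  have : Nonempty (Fin K) := ⟨d⟩
  have hle : bestReward (loweredInstance α μ d) ≤ μ d / (1 - α) := by
    refine ciSup_le fun k => ?_
    unfold loweredInstance
    split_ifs with h
    · exact le_rfl
    · rw [le_div_iff₀' hα]
      exact sub_nonpos.1 (not_lt.1 h)
  rw [IsFeasible, loweredInstance, if_neg (not_lt.2 hd)]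
  exact (le_div_iff₀' hα).1 hle

/-- This ensures that `d` itself is not lowered, also when means may be negative. Feasibility of `a`
forces `α * μ a ≥ 0`, then `μ d ≥ (1 - α) * μ a` gives `α * μ d ≥ 0`, and the gap of `d` to itself
is `-α * μ d`. -/
theorem gap_self_nonpos {α : ℝ} (hα₀ : 0 ≤ α) (hα₁ : α < 1) {μ : Fin K → ℝ} {a d : Fin K}
    (ha : IsFeasible α μ a) (had : gap α μ d a ≤ 0) : gap α μ d d ≤ 0 := by
  have hsup : μ a ≤ bestReward μ := le_ciSup (Set.finite_range μ).bddAbove a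
  have h1 : 0 ≤ α * μ a := by
    have := mul_le_mul_of_nonneg_left hsup (sub_nonneg.2 hα₁.le)
    have := ha
    rw [IsFeasible] at this
    linarith
  simp only [gap] at had ⊢
  have h2 := mul_le_mul_of_nonneg_left had hα₀
  have h3 := mul_nonneg (sub_nonneg.2 hα₁.le) h1
  linarith

/-- A lowered arm moves by exactly `gap / (1 - α)`; all other arms stay and contribute nothing. -/
theorem sum_divergence_loweredInstance {α : ℝ} (hα₁ : α < 1) (μ : Fin K → ℝ) (d : Fin K)
    (n : Fin K → ℝ) :
    2 * (1 - α) ^ 2 * ∑ k, n k * ((μ k - loweredInstance α μ d k) ^ 2 / 2) =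
      ∑ k ∈ eliminators α μ d, gap α μ d k ^ 2 * n k := by
  have hα : 1 - α ≠ 0 := (sub_pos.2 hα₁).ne'
  rw [eliminators, Finset.sum_filter, Finset.mul_sum]
  refine Finset.sum_congr rfl fun k _ => ?_
  unfold loweredInstance
  split_ifs with h
  · rw [gap]
    field_simp
  · simp

/-! ### Asymptotics of consistent policies. -/

theorem tendsto_expectedPulls_div_one {c : Fin K → ℝ} {α : ℝ} {π : ℕ → BanditPolicy K}
    (hπ : IsConsistent c α π) {μ : Fin K → ℝ} {a : Fin K} (ha : IsOptimalArm c α μ a) :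
    Tendsto (fun T : ℕ => expectedPulls (π T) μ T a / T) atTop (𝓝 1) := by
  have h0 (i : Fin K) (hi : i ∈ Finset.univ.erase a) :
      Tendsto (fun T : ℕ => expectedPulls (π T) μ T i / T) atTop (𝓝 0) := by
    -- The exponent `γ = 1` suffices: the other arms take `o(T)` of the `T` pulls.
    simpa using (hπ μ a ha i (Finset.ne_of_mem_erase hi) 1 one_pos le_rfl).tendsto_div_nhds_zero
  have h1 := (tendsto_finsetSum _ h0).const_sub 1
  simp only [Finset.sum_const_zero, sub_zero] at h1
  refine h1.congr' ?_
  filter_upwards [eventually_gt_atTop 0] with T hT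
  have hT' : (T : ℝ) ≠ 0 := Nat.cast_ne_zero.2 hT.ne'
  have := sum_expectedPulls (π T) μ T
  rw [← Finset.add_sum_erase _ _ (Finset.mem_univ a)] at this
  rw [← Finset.sum_div, eq_sub_of_add_eq' this, sub_div, div_self hT']
  ring

theorem tendsto_log_natCast : Tendsto (fun T : ℕ => Real.log T) atTop atTop :=
  Real.tendsto_log_atTop.comp tendsto_natCast_atTop_atTop

theorem tendsto_natCast_div_log : Tendsto (fun T : ℕ => (T : ℝ) / Real.log T) atTop atTop := by
  have h : Tendsto (fun x : ℝ => Real.log x / x) atTop (𝓝[>] 0) := by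
    refine tendsto_nhdsWithin_iff.2 ⟨Real.isLittleO_log_id_atTop.tendsto_div_nhds_zero, ?_⟩
    filter_upwards [eventually_gt_atTop 1] with x hx
    exact div_pos (Real.log_pos hx) (one_pos.trans hx)
  simpa [Function.comp_def] using h.inv_tendsto_nhdsGT_zero.comp tendsto_natCast_atTop_atTop

/-- If the optimal arm itself is an eliminator, it is pulled linearly often. -/
theorem tendsto_atTop_of_gap_pos {c : Fin K → ℝ} {α : ℝ} {π : ℕ → BanditPolicy K}
    (hπ : IsConsistent c α π) {μ : Fin K → ℝ} {a d : Fin K} (ha : IsOptimalArm c α μ a)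
    (had : 0 < gap α μ d a) :
    Tendsto (fun T : ℕ => (∑ i ∈ eliminators α μ d,
      gap α μ d i ^ 2 * expectedPulls (π T) μ T i) / Real.log T) atTop atTop := by
  have h := (((tendsto_expectedPulls_div_one hπ ha).pos_mul_atTop one_pos
    tendsto_natCast_div_log)).const_mul_atTop (pow_pos had 2)
  refine tendsto_atTop_mono' _ ?_ h
  filter_upwards [eventually_gt_atTop 0] with T hT
  have hT' : (T : ℝ) ≠ 0 := Nat.cast_ne_zero.2 hT.ne'
  rw [div_mul_div_cancel₀ hT', ← mul_div_assoc]
  refine div_le_div_of_nonneg_right ?_ (Real.log_natCast_nonneg T)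
  exact Finset.single_le_sum (f := fun i => gap α μ d i ^ 2 * expectedPulls (π T) μ T i)
    (fun i _ => mul_nonneg (sq_nonneg _) (expectedPulls_nonneg _ _ _ _))
    (by simpa [eliminators] using had)

/-- Two instances with different optimal arms, the first one with optimal arm `a`, have divergence
at least of the order `log T`. -/
theorem exists_tendsto_le_divergence {c : Fin K → ℝ} {α : ℝ} {π : ℕ → BanditPolicy K}
    (hπ : IsConsistent c α π) {μ ν : Fin K → ℝ} {a b : Fin K} (ha : IsOptimalArm c α μ a)
    (hb : IsOptimalArm c α ν b) (hab : a ≠ b) {γ : ℝ} (hγ₀ : 0 < γ) (hγ₁ : γ ≤ 1) :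
    ∃ u : ℕ → ℝ, Tendsto u atTop (𝓝 (1 - γ)) ∧ ∀ᶠ T : ℕ in atTop,
      u T ≤ (∑ k, expectedPulls (π T) μ T k * ((μ k - ν k) ^ 2 / 2)) / Real.log T := by
  have hy : Tendsto (fun T : ℕ => expectedPulls (π T) ν T a / (T : ℝ) ^ γ) atTop (𝓝 0) :=
    (hπ ν b hb a hab γ hγ₀ hγ₁).tendsto_div_nhds_zero
  have hlog : Tendsto (fun T : ℕ => Real.log (1 + expectedPulls (π T) ν T a / (T : ℝ) ^ γ) /
      Real.log T) atTop (𝓝 0) := by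
    refine Tendsto.div_atTop (a := 0) ?_ tendsto_log_natCast
    have := (hy.const_add 1).log (by norm_num)
    simpa using this
  refine ⟨fun T => (1 - γ) * (expectedPulls (π T) μ T a / T) -
    Real.log (1 + expectedPulls (π T) ν T a / (T : ℝ) ^ γ) / Real.log T, ?_, ?_⟩
  · simpa using ((tendsto_expectedPulls_div_one hπ ha).const_mul (1 - γ)).sub hlog
  · filter_upwards [eventually_gt_atTop 1] with T hT
    have hT0 : (0 : ℝ) < T := Nat.cast_pos.2 (one_pos.trans hT)
    have hlogT : 0 < Real.log T := Real.log_pos (Nat.one_lt_cast.2 hT)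
    -- With `l = (1 - γ) log T`, the factor `exp l / T` equals `T ^ (-γ)`, exactly the scale at
    -- which consistency on `ν` makes the logarithm's argument tend to `1`.
    have h := mul_expectedPulls_sub_log_le (π T) μ ν (one_pos.trans hT) a ((1 - γ) * Real.log T)
    have hexp : Real.exp ((1 - γ) * Real.log T) * (expectedPulls (π T) ν T a / T) =
        expectedPulls (π T) ν T a / (T : ℝ) ^ γ := by
      rw [mul_comm (1 - γ), ← Real.rpow_def_of_pos hT0, Real.rpow_sub hT0, Real.rpow_one]
      field_simp
    rw [hexp] at h
    rw [le_div_iff₀ hlogT, sub_mul, div_mul_cancel₀ _ hlogT.ne']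
    linarith

end

end CostSubsidy

theorem theorem3 {K : ℕ} (c : Fin K → ℝ) (hc : Monotone c) (α : ℝ) (hα₀ : 0 ≤ α) (hα₁ : α < 1)
    (π : ℕ → BanditPolicy K) (hπ : CostSubsidy.IsConsistent c α π)
    (μ : Fin K → ℝ) (a d : Fin K) (ha : CostSubsidy.IsOptimalArm c α μ a)
    (hd : CostSubsidy.IsBestCheapArm μ a d) :
    ((2 * (1 - α) ^ 2 : ℝ) : EReal) ≤
      liminf (fun T : ℕ =>
        (((∑ i ∈ CostSubsidy.eliminators α μ d,
          CostSubsidy.gap α μ d i ^ 2 * CostSubsidy.expectedPulls (π T) μ T i) /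
            Real.log T : ℝ) : EReal)) atTop := by
  open CostSubsidy in
  rcases lt_or_ge 0 (gap α μ d a) with had | had
  · refine le_liminf_of_le (by isBoundedDefault) ?_
    filter_upwards [(tendsto_atTop_of_gap_pos hπ ha had).eventually_ge_atTop _] with T hT
    exact EReal.coe_le_coe_iff.2 hT
  · obtain ⟨b, hb, hbd⟩ := exists_isOptimalArm_le hc
      (isFeasible_loweredInstance hα₁ (gap_self_nonpos hα₀ hα₁ ha.1 had))
    have hab : a ≠ b := (hbd.trans_lt hd.1).ne'
    -- Each fixed `γ` loses a factor `1 - γ`, which is recovered by `γ → 0` after the liminf in `T`.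
    have hγ : ∀ᶠ γ : ℝ in 𝓝[>] 0, ((2 * (1 - α) ^ 2 * (1 - γ) : ℝ) : EReal) ≤
        liminf (fun T : ℕ => (((∑ i ∈ eliminators α μ d,
          gap α μ d i ^ 2 * expectedPulls (π T) μ T i) / Real.log T : ℝ) : EReal)) atTop := by
      filter_upwards [Ioc_mem_nhdsGT (zero_lt_one' ℝ)] with γ hγ
      obtain ⟨u, hu, hle⟩ := exists_tendsto_le_divergence hπ ha hb hab hγ.1 hγ.2
      rw [← (EReal.tendsto_coe.2 (hu.const_mul (2 * (1 - α) ^ 2))).liminf_eq]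
      refine liminf_le_liminf ?_
      filter_upwards [hle] with T hT
      rw [EReal.coe_le_coe_iff, ← sum_divergence_loweredInstance hα₁, mul_div_assoc]
      exact mul_le_mul_of_nonneg_left hT (by positivity)
    refine le_of_tendsto (EReal.tendsto_coe.2 ?_) hγ
    have : Tendsto (fun γ : ℝ => 2 * (1 - α) ^ 2 * (1 - γ)) (𝓝 0) (𝓝 (2 * (1 - α) ^ 2 * (1 - 0))) :=
      Continuous.tendsto (by fun_prop) 0
    rw [sub_zero, mul_one] at this
    exact this.mono_left nhdsWithin_le_nhds
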